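/- For a topological space $X$, let $PX$ be the space of continuous paths $\gamma:[0,1]\to X$ with the compact-open topology. The topological complexity $\mathrm{TC}(X)$ is the least positive integer $k$ for which there is a \emph{motion planning algorithm} $s=\{s_i:U_i\to PX\}_{i=1}^k$ on $X$, that is, open sets $U_1,\dots,U_k$ covering $X\times X$ and continuous maps $s_i:U_i\to PX$ with $s_i(a,b)(0)=a$ and $s_i(a,b)(1)=b$ for all $(a,b)\in U_i$; if no such $k$ exists, $\mathrm{TC}(X)=\infty$. The algorithm is \emph{optimal} if $k=\mathrm{TC}(X)$. Let $m\ge 1$ and $S^{2m-1}=\{x\in\mathbb{R}^{2m}:\|x\|=1\}$, with the Euclidean norm. Then $$\mathrm{TC}(S^{2m-1})=2.$$ Moreover, the map $\nu(x_1,y_1,\dots,x_m,y_m)=(-y_1,x_1,\dots,-y_m,x_m)$ is a continuous unit tangent vector field on $S^{2m-1}$ (that is, $\|\nu(a)\|=1$ and $\langle a,\nu(a)\rangle=0$ for $a\in S^{2m-1}$), and an optimal motion planning algorithm $\{s_i:U_i\to PS^{2m-1}\}_{i=1}^2$ is given by $$U_1=\{(a,b): a\ne -b\},\qquad s_1(a,b)(t)=\frac{(1-t)a+tb}{\|(1-t)a+tb\|},$$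 $$U_2=\{(a,b): a\ne b\},\qquad s_2(a,b)(t)=\begin{cases}s_1(a,-b)(2t), & 0\le t\le 1/2,\\ \alpha(-b,b)(2t-1), & 1/2\le t\le 1,\end{cases}$$ where, for $a=-b$, $$\alpha(a,b)(t)=\begin{cases}s_1(a,\nu(a))(2t), & 0\le t\le 1/2,\\ s_1(\nu(a),b)(2t-1), & 1/2\le t\le 1.\end{cases}$$ For $(a,b)\in U_1$ the path $s_1(a,b)$ has the least length among all continuous paths in $S^{2m-1}$ from $a$ to $b$. -/

import Mathlib

open scoped unitInterval

noncomputable section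

/-- A motion planning algorithm `{s i : U i → PX}`, `i < k`, on `X`: an open cover of `X × X` by
`k` sets, with a continuous local section over each of them of the end-point map
`PX → X × X`, `γ ↦ (γ 0, γ 1)`. The path space `PX` is `C(I, X)` with its compact-open topology. -/
structure MotionPlanner (X : Type*) [TopologicalSpace X] (k : ℕ) where
  /-- The domains of the local algorithms. -/
  U : Fin k → Set (X × X)
  isOpen_U : ∀ i, IsOpen (U i)
  iUnion_U : ⋃ i, U i = Set.univ
  /-- The local algorithms. -/
  s : ∀ i, U i → C(I, X)
  continuous_s : ∀ i, Continuous (s i)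
  source_s : ∀ i (p : U i), s i p 0 = p.1.1
  target_s : ∀ i (p : U i), s i p 1 = p.1.2

/-- The topological complexity of `X` (non-reduced): the least positive integer `k` for which there
is a motion planning algorithm with `k` local algorithms, and `⊤` if there is none. -/
def topologicalComplexity (X : Type*) [TopologicalSpace X] : ℕ∞ :=
  sInf {n : ℕ∞ | ∃ k : ℕ, 1 ≤ k ∧ Nonempty (MotionPlanner X k) ∧ n = k}

/-- An algorithm is optimal if the number of its local algorithms is the topological complexity. -/
def MotionPlanner.IsOptimal {X : Type*} [TopologicalSpace X] {k : ℕ} (_ : MotionPlanner X k) :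
    Prop :=
  (k : ℕ∞) = topologicalComplexity X

/-- The sphere `S^{2m-1}`, the Euclidean unit sphere of `ℝ^{2m}`. -/
abbrev OddSphere (m : ℕ) : Type :=
  Metric.sphere (0 : EuclideanSpace ℝ (Fin (2 * m))) 1

/-- `ν (x₁, y₁, …, xₘ, yₘ) = (-y₁, x₁, …, -yₘ, xₘ)`. The coordinates are numbered from `0`, so
that the `xᵢ` sit at the even places and the `yᵢ` at the odd ones. -/
def rotField {m : ℕ} (v : EuclideanSpace ℝ (Fin (2 * m))) : EuclideanSpace ℝ (Fin (2 * m)) :=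
  WithLp.toLp 2 fun k =>
    if h : k.1 % 2 = 0 then -v ⟨k.1 + 1, by omega⟩ else v ⟨k.1 - 1, by omega⟩

/-- The normalized segment `((1 - t) a + t b) / ‖(1 - t) a + t b‖`. -/
def normalizedSegment {E : Type*} [NormedAddCommGroup E] [NormedSpace ℝ E] (a b : E) (t : ℝ) : E :=
  ‖(1 - t) • a + t • b‖⁻¹ • ((1 - t) • a + t • b)

/-- The path from `a` to `b` through `ν a`, used for antipodal `a` and `b`: the normalized segment
from `a` to `ν a`, followed by that from `ν a` to `b`. -/
def antipodalPath {m : ℕ} (a b : EuclideanSpace ℝ (Fin (2 * m))) (t : ℝ) :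
    EuclideanSpace ℝ (Fin (2 * m)) :=
  if t ≤ 1 / 2 then normalizedSegment a (rotField a) (2 * t)
  else normalizedSegment (rotField a) b (2 * t - 1)

/-- The path from `a` to `b` through `-b`, used for `a ≠ b`: the normalized segment from `a` to
`-b`, followed by the path from `-b` to its antipode `b`. -/
def detourPath {m : ℕ} (a b : EuclideanSpace ℝ (Fin (2 * m))) (t : ℝ) :
    EuclideanSpace ℝ (Fin (2 * m)) :=
  if t ≤ 1 / 2 then normalizedSegment a (-b) (2 * t)
  else antipodalPath (-b) b (2 * t - 1)

/-- The length of a path on the sphere, as a path in the ambient Euclidean space. -/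
def OddSphere.pathLength {m : ℕ} (γ : C(I, OddSphere m)) : ENNReal :=
  eVariationOn (fun t : I => (γ t : EuclideanSpace ℝ (Fin (2 * m)))) Set.univ

end

/-! The two explicit local algorithms give the upper bound. They cover because no unit vector is its
own antipode, and the detour is well defined because `ν` is tangent. For the lower bound, a single
global algorithm with the target frozen at a point `a` would contract the sphere to `a`.

That the sphere is not contractible follows from an analytic no-retraction theorem
(`not_exists_contDiff_retraction_sphere`). A contraction gives, after smoothing, a `C¹` map `r` into
the unit sphere that fixes the sphere. Put `g = r - id`. For small `t > 0` the map `id + t g`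
permutes the unit ball, so the integral of `det (1 + t Dg)` over it is the volume of the ball. The
integrand is polynomial in `t`, so the identity persists at `t = 1`; but there the integrand is `det
Dr = 0`, since `r` has constant norm.

For minimality, the angle between the end points bounds the length of any path on the sphere from
below, and normalized segments attain it because angles add along them. -/

noncomputable section

/-! ### Polynomial dependence of the Jacobian on the parameter -/

open MeasureTheory Metric Polynomial in
/-- Values at `1` of polynomials of degree at most `n` are a fixed linear combination of the values
at finitely many points of `(0, δ)`. -/
theorem Polynomial.exists_extrapolation (n : ℕ) {δ : ℝ} (hδ : 0 < δ) :
    ∃ c v : Fin (n + 1) → ℝ, (∀ i, 0 < v i ∧ v i < δ) ∧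
      ∀ p : ℝ[X], p.natDegree ≤ n → p.eval 1 = ∑ i, c i * p.eval (v i) := by
  -- Equally spaced nodes; the shift in `i + 1` and the denominator `n + 2` keep them strictly
  -- inside `(0, δ)`.
  let v : Fin (n + 1) → ℝ := fun i => δ * ((i + 1 : ℝ) / (n + 2))
  have hv : Set.InjOn v (Finset.univ : Finset (Fin (n + 1))) := by
    intro i _ j _ h
    have h1 : ((i : ℕ) : ℝ) = (j : ℕ) := by
      have : (n + 2 : ℝ) ≠ 0 := by positivity
      simp only [v] at h
      field_simp at h
      linarith
    exact Fin.ext (by exact_mod_cast h1)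
  refine ⟨fun i => (Lagrange.basis Finset.univ v i).eval 1, v, fun i => ⟨by positivity, ?_⟩, ?_⟩
  · have hi : ((i : ℕ) : ℝ) + 1 < n + 2 := by
      have := i.2
      have : (i : ℕ) + 1 < n + 2 := by omega
      exact_mod_cast this
    have : ((i : ℝ) + 1) / (n + 2) < 1 := by
      rw [div_lt_one (by positivity)]; exact hi
    simpa using mul_lt_mul_of_pos_left this hδ
  · intro p hp
    have hdeg : p.degree < (Finset.univ : Finset (Fin (n + 1))).card := by
      rw [Finset.card_univ, Fintype.card_fin]
      exact lt_of_le_of_lt (Polynomial.degree_le_of_natDegree_le hp) (by exact_mod_cast n.lt_succ_self)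
    conv_lhs => rw [Lagrange.eq_interpolate hv hdeg]
    simp [Lagrange.interpolate_apply, Polynomial.eval_finsetSum, mul_comm]

open Polynomial in
theorem LinearMap.exists_det_one_add_smul_eq_eval {E : Type*} [AddCommGroup E] [Module ℝ E]
    [FiniteDimensional ℝ E] (A : E →ₗ[ℝ] E) :
    ∃ p : ℝ[X], p.natDegree ≤ Module.finrank ℝ E ∧
      ∀ t : ℝ, p.eval t = LinearMap.det (1 + t • A) := by
  let b := Module.finBasis ℝ E
  let M := LinearMap.toMatrix b b A
  refine ⟨((X : ℝ[X]) • M.map C + (1 : Matrix _ _ ℝ).map C).det, ?_, fun t => ?_⟩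
  · simpa using Polynomial.natDegree_det_X_add_C_le M 1
  · rw [← LinearMap.det_toMatrix b, ← Polynomial.coe_evalRingHom, RingHom.map_det]
    congr 1
    rw [map_add (LinearMap.toMatrix b b), map_smul (LinearMap.toMatrix b b),
      LinearMap.toMatrix_one]
    ext i j
    by_cases h : i = j <;> simp [M, h, add_comm] <;> exact mul_comm _ _

/-! ### No differentiable retraction onto the sphere -/

section Retraction

variable {E : Type*} [NormedAddCommGroup E] [InnerProductSpace ℝ E] [FiniteDimensional ℝ E]

/-- Along `1 + t A`, `0 ≤ t ≤ 1`, every operator is invertible by the Neumann series, so the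
determinant cannot change sign from its value `1` at `t = 0`. -/
theorem ContinuousLinearMap.det_one_add_pos {A : E →L[ℝ] E} (hA : ‖A‖ < 1) :
    0 < LinearMap.det (1 + (A : E →ₗ[ℝ] E)) := by
  obtain ⟨p, -, hp⟩ := LinearMap.exists_det_one_add_smul_eq_eval (A : E →ₗ[ℝ] E)
  have hne : ∀ t ∈ Set.Icc (0 : ℝ) 1, p.eval t ≠ 0 := by
    intro t ht h0
    rw [hp t] at h0
    have hu : IsUnit (1 + t • A) := by
      have : ‖-(t • A)‖ < 1 := by
        rw [norm_neg, norm_smul, Real.norm_eq_abs, abs_of_nonneg ht.1]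
        nlinarith [norm_nonneg A, ht.2]
      simpa using isUnit_one_sub_of_norm_lt_one this
    have hu' : IsUnit (1 + t • (A : E →ₗ[ℝ] E)) :=
      hu.map (ContinuousLinearMap.toLinearMapRingHom (R₁ := ℝ) (M₁ := E))
    exact ((LinearMap.isUnit_iff_isUnit_det _).1 hu').ne_zero h0
  have h0 : p.eval 0 = 1 := by rw [hp 0]; simp
  have h1 : LinearMap.det (1 + (A : E →ₗ[ℝ] E)) = p.eval 1 := by rw [hp 1, one_smul]
  rw [h1]
  by_contra hle
  obtain ⟨t, ht, h⟩ := intermediate_value_Icc' zero_le_one p.continuous.continuousOn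
    (show (0 : ℝ) ∈ Set.Icc (p.eval 1) (p.eval 0) from ⟨not_lt.1 hle, by rw [h0]; exact zero_le_one⟩)
  exact hne t ht h

omit [FiniteDimensional ℝ E] in
open Metric in
/-- Extending by zero keeps the Lipschitz constant, if the function vanishes on the boundary. -/
theorem LipschitzOnWith.indicator_ball {F : Type*} [NormedAddCommGroup F] {g : E → F} {K : NNReal}
    {R : ℝ} (hg : LipschitzOnWith K g (closedBall 0 R)) (h0 : ∀ x ∈ sphere (0 : E) R, g x = 0) :
    LipschitzWith K ((ball (0 : E) R).indicator g) := by
  have key : ∀ x ∈ ball (0 : E) R, ∀ y ∉ ball (0 : E) R, dist (g x) 0 ≤ K * dist x y := by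
    intro x hx y hy
    rw [mem_ball_zero_iff] at hx hy
    -- The segment from `x` to `y` crosses the sphere, where `g` vanishes, at a point no farther
    -- from `x` than `y` is.
    obtain ⟨t, ht, h⟩ : ∃ t ∈ Set.Icc (0 : ℝ) 1, ‖AffineMap.lineMap x y t‖ = R := by
      have hc : ContinuousOn (fun t : ℝ => ‖AffineMap.lineMap x y t‖) (Set.Icc 0 1) := by
        have : Continuous (fun t : ℝ => AffineMap.lineMap x y t) := AffineMap.lineMap_continuous
        fun_prop
      have := intermediate_value_Icc zero_le_one hc
      exact this ⟨by simpa using hx.le, by simpa using not_lt.1 hy⟩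
    have hz := h0 (AffineMap.lineMap x y t) (by simpa using h)
    calc dist (g x) 0 = dist (g x) (g (AffineMap.lineMap x y t)) := by rw [hz]
      _ ≤ K * dist x (AffineMap.lineMap x y t) :=
        hg.dist_le_mul _ (by simpa using hx.le) _ (by simpa using h.le)
      _ ≤ K * dist x y := by
        gcongr
        rw [dist_left_lineMap, Real.norm_eq_abs, abs_of_nonneg ht.1]
        nlinarith [ht.2, dist_nonneg (x := x) (y := y)]
  refine LipschitzWith.of_dist_le_mul fun x y => ?_
  by_cases hx : x ∈ ball (0 : E) R <;> by_cases hy : y ∈ ball (0 : E) R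
  · rw [Set.indicator_of_mem hx, Set.indicator_of_mem hy]
    exact hg.dist_le_mul _ (ball_subset_closedBall hx) _ (ball_subset_closedBall hy)
  · rw [Set.indicator_of_mem hx, Set.indicator_of_notMem hy]
    exact key x hx y hy
  · rw [Set.indicator_of_notMem hx, Set.indicator_of_mem hy, dist_comm, dist_comm x]
    exact key y hy x hx
  · rw [Set.indicator_of_notMem hx, Set.indicator_of_notMem hy, dist_self]
    positivity

open Metric MeasureTheory in
/-- The volume of the ball is the integral of the Jacobian of a small Lipschitz perturbation of the
identity that is supported in the ball. -/
theorem integral_det_one_add_smul_fderiv_ball [MeasurableSpace E] [BorelSpace E]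
    (μ : Measure E) [μ.IsAddHaarMeasure] {g : E → E} {K : NNReal} (hd : Differentiable ℝ g)
    (hg : LipschitzOnWith K g (closedBall 0 1)) (h0 : ∀ x ∈ sphere (0 : E) 1, g x = 0)
    {t : ℝ} (ht : 0 < t) (htK : t * K < 1) :
    IntegrableOn (fun x => LinearMap.det (1 + t • (fderiv ℝ g x : E →ₗ[ℝ] E))) (ball 0 1) μ ∧
    ∫ x in ball (0 : E) 1, LinearMap.det (1 + t • (fderiv ℝ g x : E →ₗ[ℝ] E)) ∂μ =
      μ.real (ball 0 1) := by
  set G := (ball (0 : E) 1).indicator g with hG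
  have hGl : LipschitzWith K G := hg.indicator_ball h0
  let f : E → E := fun x => x + t • G x
  have hfo : ∀ x ∉ ball (0 : E) 1, f x = x := fun x hx => by
    simp [f, hG, Set.indicator_of_notMem hx]
  -- Since `t K < 1`, `f` is a Lipschitz perturbation of the identity small enough to be bijective;
  -- being the identity off the ball, it then permutes the ball.
  have happ : ApproximatesLinearOn f ((ContinuousLinearEquiv.refl ℝ E : E ≃L[ℝ] E) : E →L[ℝ] E)
      Set.univ (Real.toNNReal t * K) := by
    intro x _ y _
    have : f x - f y - ((ContinuousLinearEquiv.refl ℝ E : E ≃L[ℝ] E) : E →L[ℝ] E) (x - y)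
        = t • (G x - G y) := by
      simp [f, smul_sub]; abel
    rw [this, norm_smul, NNReal.coe_mul, Real.coe_toNNReal t ht.le, Real.norm_eq_abs,
      abs_of_pos ht, mul_assoc]
    gcongr
    simpa [dist_eq_norm] using hGl.dist_le_mul x y
  have hc : Subsingleton E ∨ Real.toNNReal t * K <
      ‖((ContinuousLinearEquiv.refl ℝ E).symm : E →L[ℝ] E)‖₊⁻¹ := by
    rcases subsingleton_or_nontrivial E with h | h
    · exact Or.inl h
    · right
      have : ‖((ContinuousLinearEquiv.refl ℝ E).symm : E →L[ℝ] E)‖₊ = 1 := by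
        simp
      rw [this, inv_one, ← NNReal.coe_lt_coe, NNReal.coe_mul, Real.coe_toNNReal t ht.le]
      simpa using htK
  have hinj : Function.Injective f := by
    have := happ.injOn hc
    rwa [Set.injOn_univ] at this
  have hsurj : Function.Surjective f := happ.surjective hc
  have himg : f '' ball 0 1 = ball 0 1 := by
    apply Set.Subset.antisymm
    · rintro _ ⟨x, hx, rfl⟩
      by_contra h
      exact h ((hinj (hfo _ h)).symm ▸ hx)
    · intro y hy
      obtain ⟨x, rfl⟩ := hsurj y
      refine ⟨x, ?_, rfl⟩
      by_contra h
      exact h (hfo x h ▸ hy)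
  have hder : ∀ x ∈ ball (0 : E) 1,
      HasFDerivWithinAt f (1 + t • fderiv ℝ g x) (ball 0 1) x := by
    intro x hx
    have h1 : HasFDerivAt (fun x => x + t • g x) (1 + t • fderiv ℝ g x) x :=
      (hasFDerivAt_id x).add ((hd x).hasFDerivAt.const_smul t)
    refine h1.hasFDerivWithinAt.congr (fun y hy => ?_) ?_
    · simp [f, hG, Set.indicator_of_mem hy]
    · simp [f, hG, Set.indicator_of_mem hx]
  have hpos : ∀ x ∈ ball (0 : E) 1, 0 < LinearMap.det (1 + t • (fderiv ℝ g x : E →ₗ[ℝ] E)) := by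
    intro x hx
    have hn : ‖t • fderiv ℝ g x‖ < 1 := by
      rw [norm_smul, Real.norm_eq_abs, abs_of_pos ht]
      have := norm_fderiv_le_of_lipschitzOn ℝ (closedBall_mem_nhds_of_mem hx) hg
      nlinarith
    exact ContinuousLinearMap.det_one_add_pos hn
  have habs : Set.EqOn (fun x => |(1 + t • fderiv ℝ g x : E →L[ℝ] E).det| • (1 : ℝ))
      (fun x => LinearMap.det (1 + t • (fderiv ℝ g x : E →ₗ[ℝ] E))) (ball 0 1) := fun x hx => by
    have : (1 + t • fderiv ℝ g x : E →L[ℝ] E).det =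
      LinearMap.det (1 + t • (fderiv ℝ g x : E →ₗ[ℝ] E)) := rfl
    simp only [this, abs_of_pos (hpos x hx), smul_eq_mul, mul_one]
  constructor
  · have := (integrableOn_image_iff_integrableOn_abs_det_fderiv_smul μ measurableSet_ball hder
      hinj.injOn (fun _ => (1 : ℝ))).1 (by rw [himg]; exact integrableOn_const measure_ball_lt_top.ne)
    exact this.congr_fun habs measurableSet_ball
  · have := integral_image_eq_integral_abs_det_fderiv_smul μ measurableSet_ball hder hinj.injOn
      (fun _ => (1 : ℝ))
    rw [himg, setIntegral_congr_fun measurableSet_ball habs] at this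
    simpa using this.symm

open Metric MeasureTheory in
/-- There is no continuously differentiable retraction onto the unit sphere. -/
theorem not_exists_contDiff_retraction_sphere {r : E → E} (hr : ContDiff ℝ 1 r)
    (hr1 : ∀ x, ‖r x‖ = 1) (hid : ∀ x, ‖x‖ = 1 → r x = x) : False := by
  borelize E
  let μ : Measure E := Measure.addHaar
  have hgc : ContDiff ℝ 1 (fun x => r x - x) := hr.sub contDiff_id
  set g : E → E := fun x => r x - x with hg
  obtain ⟨K, hK⟩ : ∃ K, LipschitzOnWith K g (closedBall 0 1) :=
    hgc.locallyLipschitz.locallyLipschitzOn.exists_lipschitzOnWith_of_compact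
      (isCompact_closedBall 0 1)
  have h0 : ∀ x ∈ sphere (0 : E) 1, g x = 0 := fun x hx => by
    simp [hg, hid x (by simpa using hx)]
  have hd : Differentiable ℝ g := hgc.differentiable (by norm_num)
  obtain ⟨c, v, hv, hp⟩ := Polynomial.exists_extrapolation (Module.finrank ℝ E)
    (δ := 1 / (K + 1)) (by positivity)
  have hvK : ∀ i, v i * K < 1 := fun i => by
    have h1 := (hv i).2
    have h2 := (hv i).1
    rw [lt_div_iff₀ (by positivity)] at h1
    nlinarith
  have key := fun i => integral_det_one_add_smul_fderiv_ball μ hd hK h0 (hv i).1 (hvK i)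
  have hc1 : ∑ i, c i = 1 := by simpa using (hp 1 (by simp)).symm
  have hzero : ∀ x, LinearMap.det (1 + (1 : ℝ) • (fderiv ℝ g x : E →ₗ[ℝ] E)) = 0 := by
    intro x
    have hfd : fderiv ℝ g x = fderiv ℝ r x - 1 := by
      have hrx : DifferentiableAt ℝ r x := hr.differentiable (by norm_num) x
      exact (hrx.hasFDerivAt.sub (hasFDerivAt_id x)).fderiv
    have : (1 + (1 : ℝ) • (fderiv ℝ g x : E →ₗ[ℝ] E)) = (fderiv ℝ r x : E →ₗ[ℝ] E) := by
      ext y; simp [hfd]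
    rw [this]
    by_contra hne
    have hrx : HasFDerivAt r (fderiv ℝ r x) x := (hr.differentiable (by norm_num) x).hasFDerivAt
    have hu : IsUnit (fderiv ℝ r x : E →ₗ[ℝ] E) :=
      (LinearMap.isUnit_iff_isUnit_det _).2 (isUnit_iff_ne_zero.2 hne)
    -- An invertible derivative would move `r x` in its own radial direction, contradicting the
    -- derivative of `⟨r, r⟩ = 1`.
    obtain ⟨y, hy⟩ := ((Module.End.isUnit_iff _).1 hu).2 (r x)
    have hin := hrx.inner ℝ hrx
    have hconst : (fun x => inner ℝ (r x) (r x)) = fun _ => (1 : ℝ) := by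
      ext z; rw [real_inner_self_eq_norm_sq, hr1, one_pow]
    rw [hconst] at hin
    have h2 := congrArg (fun L => L y) (hin.unique (hasFDerivAt_const (1 : ℝ) x))
    have hy' : fderiv ℝ r x y = r x := hy
    simp [hy', hr1] at h2
  have hsum : ∫ x in ball (0 : E) 1, LinearMap.det (1 + (1 : ℝ) • (fderiv ℝ g x : E →ₗ[ℝ] E)) ∂μ =
      μ.real (ball 0 1) := by
    -- The weights and nodes do not depend on `x`, so extrapolation commutes with the integral.
    have : ∀ x, LinearMap.det (1 + (1 : ℝ) • (fderiv ℝ g x : E →ₗ[ℝ] E)) =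
        ∑ i, c i * LinearMap.det (1 + v i • (fderiv ℝ g x : E →ₗ[ℝ] E)) := by
      intro x
      obtain ⟨p, hdeg, he⟩ := LinearMap.exists_det_one_add_smul_eq_eval (fderiv ℝ g x : E →ₗ[ℝ] E)
      simp only [← he]
      exact hp p hdeg
    simp only [this]
    rw [integral_finsetSum _ fun i _ => (key i).1.const_mul (c i)]
    simp only [integral_const_mul, (key _).2, ← Finset.sum_mul, hc1, one_mul]
  simp only [hzero, integral_zero] at hsum
  exact (ENNReal.toReal_pos (measure_ball_pos μ (0 : E) one_pos).ne' measure_ball_lt_top.ne).ne hsum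

end Retraction

/-! ### Non-contractibility of the sphere -/

section Contraction

variable {E : Type*} [NormedAddCommGroup E] [InnerProductSpace ℝ E]

open Metric in
/-- Normalization as a map to the unit sphere, with the value `a` at the origin. -/
def sphereNormalize (a : sphere (0 : E) 1) (x : E) : sphere (0 : E) 1 :=
  open Classical in
  if h : x = 0 then a else ⟨‖x‖⁻¹ • x, by simp [norm_smul, h]⟩

open Metric in
theorem coe_sphereNormalize (a : sphere (0 : E) 1) {x : E} (hx : x ≠ 0) :
    (sphereNormalize a x : E) = ‖x‖⁻¹ • x := by
  simp [sphereNormalize, hx]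

open Metric in
theorem continuousAt_sphereNormalize (a : sphere (0 : E) 1) {x : E} (hx : x ≠ 0) :
    ContinuousAt (sphereNormalize a) x := by
  rw [Topology.IsInducing.subtypeVal.continuousAt_iff]
  have h : ContinuousAt (fun x : E => ‖x‖⁻¹ • x) x :=
    (continuousAt_id.norm.inv₀ (by simpa using hx)).smul continuousAt_id
  refine h.congr ?_
  filter_upwards [isOpen_ne.mem_nhds hx] with y hy
  exact (coe_sphereNormalize a hy).symm

open Metric Filter Topology in
/-- The unit sphere of a finite-dimensional inner product space is not contractible. -/
theorem sphere_not_contractible [FiniteDimensional ℝ E] (a : sphere (0 : E) 1)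
    {H : sphere (0 : E) 1 × I → sphere (0 : E) 1} (hH : Continuous H) (h0 : ∀ x, H (x, 0) = x)
    (h1 : ∀ x, H (x, 1) = a) : False := by
  -- The contraction is run as the radius falls from `1` to `1/2`: `f` is constant near the origin,
  -- where normalization is discontinuous, and radial projection outside the unit ball.
  let τ : E → I := fun x => Set.projIcc 0 1 zero_le_one (2 - 2 * ‖x‖)
  have hτ : Continuous τ := continuous_projIcc.comp (by fun_prop)
  have hτ1 : ∀ x, ‖x‖ ≤ 1 / 2 → τ x = 1 := fun x hx =>
    Set.projIcc_of_right_le zero_le_one (by linarith)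
  have hτ0 : ∀ x, 1 ≤ ‖x‖ → τ x = 0 := fun x hx =>
    Set.projIcc_of_le_left zero_le_one (by linarith)
  let f : E → E := fun x => H (sphereNormalize a x, τ x)
  have hf1 : ∀ x, ‖f x‖ = 1 := fun x => by simp [f]
  have hfo : ∀ x, 1 ≤ ‖x‖ → f x = ‖x‖⁻¹ • x := fun x hx => by
    have hx0 : x ≠ 0 := by rintro rfl; norm_num at hx
    simp only [f]
    rw [hτ0 x hx, h0, coe_sphereNormalize a hx0]
  have hf : Continuous f := by
    rw [continuous_iff_continuousAt]
    intro x
    by_cases hx : x = 0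
    · have : f =ᶠ[𝓝 x] fun _ => (a : E) := by
        filter_upwards [ball_mem_nhds x (show (0 : ℝ) < 1 / 2 by norm_num)] with y hy
        simp only [f]
        rw [hτ1 y (by simpa [hx] using (mem_ball.1 hy).le), h1]
      exact continuousAt_const.congr this.symm
    · exact (continuous_subtype_val.comp hH).continuousAt.comp
        ((continuousAt_sphereNormalize a hx).prodMk hτ.continuousAt)
  have hS : IsClosed {x : E | 2 ≤ ‖x‖} := isClosed_le continuous_const continuous_norm
  have hU : {x : E | 1 < ‖x‖} ∈ 𝓝ˢ {x : E | 2 ≤ ‖x‖} :=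
    (isOpen_lt continuous_const continuous_norm).mem_nhdsSet.2 fun x (hx : 2 ≤ ‖x‖) =>
      show 1 < ‖x‖ by linarith
  have hfU : ContDiffOn ℝ (1 : ℕ∞) f {x : E | 1 < ‖x‖} := by
    have hne : ∀ x ∈ {x : E | 1 < ‖x‖}, x ≠ 0 := by
      rintro x hx rfl
      simp only [Set.mem_ofPred_eq, norm_zero] at hx
      linarith
    have : ContDiffOn ℝ (1 : ℕ∞) (fun x : E => ‖x‖⁻¹ • x) {x : E | 1 < ‖x‖} :=
      ((contDiffOn_id.norm ℝ hne).inv fun x hx => norm_ne_zero_iff.2 (hne x hx)).smul contDiffOn_id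
    exact this.congr fun x hx => hfo x (le_of_lt hx)
  -- Smoothing with error below `1/2` keeps `g` nonzero and leaves `f` unchanged where `2 ≤ ‖x‖`.
  -- Rescaling by `2` then brings the sphere of radius `2` to the unit sphere.
  obtain ⟨g, hg, hgf, hgS, -⟩ := hf.exists_contDiff_approx_and_eqOn (1 : ℕ∞) (ε := fun _ => 1 / 2)
    continuous_const (fun _ => by norm_num) hS hU hfU
  have hg0 : ∀ x, g x ≠ 0 := fun x hx => by
    have := hgf x
    rw [hx, dist_zero_left, hf1] at this
    norm_num at this
  have hg2 : ContDiff ℝ 1 fun x => g ((2 : ℝ) • x) := hg.comp (contDiff_id.const_smul (2 : ℝ))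
  refine not_exists_contDiff_retraction_sphere (r := fun x => ‖g ((2 : ℝ) • x)‖⁻¹ • g ((2 : ℝ) • x))
    (((hg2.norm ℝ fun x => hg0 _).inv fun x => norm_ne_zero_iff.2 (hg0 _)).smul hg2) ?_ ?_
  · intro x
    simp [norm_smul, hg0]
  · intro x hx
    have hn : ‖(2 : ℝ) • x‖ = 2 := by simp [norm_smul, hx]
    have : g ((2 : ℝ) • x) = x := by
      rw [hgS (show (2 : ℝ) • x ∈ {x : E | 2 ≤ ‖x‖} from hn.ge), hfo _ (by rw [hn]; norm_num), hn,
        smul_smul]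
      norm_num
    simp [this, hx]

end Contraction

theorem two_le_topologicalComplexity_oddSphere {m : ℕ} (hm : 1 ≤ m) :
    2 ≤ topologicalComplexity (OddSphere m) := by
  refine le_sInf ?_
  rintro _ ⟨k, hk, ⟨P⟩, rfl⟩
  by_contra hlt
  obtain rfl : k = 1 := by
    have : k < 2 := by exact_mod_cast not_le.1 hlt
    omega
  have hU : ∀ p, p ∈ P.U 0 := fun p => by
    obtain ⟨i, hi⟩ := Set.mem_iUnion.1 (P.iUnion_U.symm ▸ Set.mem_univ p)
    rwa [Subsingleton.elim i 0] at hi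
  let a : OddSphere m := ⟨EuclideanSpace.single ⟨0, by omega⟩ 1, by simp⟩
  have hc : Continuous fun x : OddSphere m => P.s 0 ⟨(x, a), hU _⟩ :=
    (P.continuous_s 0).comp (by fun_prop)
  refine sphere_not_contractible a (H := fun q => P.s 0 ⟨(q.1, a), hU _⟩ q.2) ?_ ?_ ?_
  · exact ContinuousEval.continuous_eval.comp ((hc.comp continuous_fst).prodMk continuous_snd)
  · exact fun x => P.source_s 0 ⟨(x, a), hU _⟩
  · exact fun x => P.target_s 0 ⟨(x, a), hU _⟩

/-! ### Angles and lengths of paths on the sphere -/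

section Length

variable {E : Type*} [NormedAddCommGroup E] [InnerProductSpace ℝ E]

open InnerProductGeometry

theorem norm_sub_eq_two_mul_sin_half_angle {x y : E} (hx : ‖x‖ = 1) (hy : ‖y‖ = 1) :
    ‖x - y‖ = 2 * Real.sin (angle x y / 2) := by
  have hs : 0 ≤ Real.sin (angle x y / 2) :=
    Real.sin_nonneg_of_nonneg_of_le_pi (by linarith [angle_nonneg x y])
      (by linarith [angle_le_pi x y, angle_nonneg x y])
  rw [← sq_eq_sq₀ (norm_nonneg _) (by positivity), norm_sub_sq_real, hx, hy,
    inner_eq_cos_angle_of_norm_eq_one hx hy, mul_pow, Real.sin_sq_eq_half_sub]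
  rw [mul_div_cancel₀ _ (two_ne_zero' ℝ)]
  ring

theorem norm_sub_le_angle {x y : E} (hx : ‖x‖ = 1) (hy : ‖y‖ = 1) : ‖x - y‖ ≤ angle x y := by
  rw [norm_sub_eq_two_mul_sin_half_angle hx hy]
  have := Real.sin_le (x := angle x y / 2) (by linarith [angle_nonneg x y])
  linarith

/-- Chords and arcs are infinitesimally equal. -/
theorem exists_forall_mul_angle_le_norm_sub {c : ℝ} (hc : c < 1) :
    ∃ δ > 0, ∀ x y : E, ‖x‖ = 1 → ‖y‖ = 1 → ‖x - y‖ < δ → c * angle x y ≤ ‖x - y‖ := by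
  -- Jordan's inequality bounds the half-angle `θ` by the chord, so `θ * θ ≤ 1 - c`; the cubic lower
  -- bound for the sine then suffices.
  refine ⟨min (1 / 2) (1 - c), lt_min (by norm_num) (by linarith), fun x y hx hy h => ?_⟩
  have h1 := h.trans_le (min_le_left _ _)
  have h2 := h.trans_le (min_le_right _ _)
  rw [norm_sub_eq_two_mul_sin_half_angle hx hy] at h1 h2 ⊢
  set θ := angle x y / 2 with hθ
  have hθ0 : 0 ≤ θ := by linarith [angle_nonneg x y]
  have hθπ : θ ≤ Real.pi / 2 := by linarith [angle_le_pi x y]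
  have hang : angle x y = 2 * θ := by rw [hθ]; ring
  have hj := Real.mul_le_sin hθ0 hθπ
  have hjord : θ ≤ 2 * Real.sin θ := by
    rw [div_mul_eq_mul_div, div_le_iff₀ Real.pi_pos] at hj
    have hs : 0 ≤ Real.sin θ := Real.sin_nonneg_of_nonneg_of_le_pi hθ0 (by linarith)
    nlinarith [Real.pi_le_four]
  rw [hang]
  rcases hθ0.eq_or_lt with h0 | h0
  · simp [← h0]
  · have := Real.sin_gt_sub_cube h0
    have h3 : θ * θ ≤ (1 - c) := by nlinarith
    nlinarith [mul_le_mul_of_nonneg_left h3 h0.le]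

theorem angle_le_sum_angle (u : ℕ → E) (n : ℕ) (h0 : u 0 ≠ 0) :
    angle (u 0) (u n) ≤ ∑ i ∈ Finset.range n, angle (u i) (u (i + 1)) := by
  induction n with
  | zero => simp [angle_self h0]
  | succ n ih =>
    rw [Finset.sum_range_succ]
    linarith [angle_le_angle_add_angle (u 0) (u n) (u (n + 1))]

open Filter Topology in
/-- A path on the unit sphere is at least as long as the angle between its end points. -/
theorem ofReal_angle_le_eVariationOn {γ : I → E} (hγ : Continuous γ) (h1 : ∀ t, ‖γ t‖ = 1) :
    ENNReal.ofReal (angle (γ 0) (γ 1)) ≤ eVariationOn γ Set.univ := by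
  -- On a fine subdivision chords are at least `c` times the angles, and angles satisfy the triangle
  -- inequality. The loss disappears as `c → 1`.
  have key : ∀ c : ℝ, 0 ≤ c → c < 1 →
      ENNReal.ofReal (c * angle (γ 0) (γ 1)) ≤ eVariationOn γ Set.univ := by
    intro c hc0 hc
    obtain ⟨δ, hδ, hδc⟩ := exists_forall_mul_angle_le_norm_sub (E := E) hc
    obtain ⟨η, hη, hγη⟩ := Metric.uniformContinuous_iff.1
      (CompactSpace.uniformContinuous_of_continuous hγ) δ hδ
    obtain ⟨N, hN⟩ := exists_nat_one_div_lt hη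
    let u : ℕ → I := fun i => Set.projIcc 0 1 zero_le_one ((i : ℝ) / (N + 1))
    have hu : Monotone u := fun i j hij => Set.monotone_projIcc _ (by gcongr)
    have hu0 : u 0 = 0 := Set.projIcc_of_le_left _ (by simp)
    have hu1 : u (N + 1) = 1 := Set.projIcc_of_right_le _ (by
      rw [Nat.cast_add, Nat.cast_one, div_self (by positivity)])
    have hstep : ∀ i, dist (γ (u (i + 1))) (γ (u i)) < δ := by
      intro i
      refine hγη (lt_of_le_of_lt ?_ hN)
      have := (LipschitzWith.projIcc (a := (0 : ℝ)) (b := 1) zero_le_one).dist_le_mul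
        (((i + 1 : ℕ) : ℝ) / (N + 1)) ((i : ℝ) / (N + 1))
      refine this.trans ?_
      rw [Real.dist_eq, ← sub_div, Nat.cast_add, Nat.cast_one, add_sub_cancel_left,
        abs_of_nonneg (by positivity)]
      simp
    refine le_trans ?_ (eVariationOn.sum_le (f := γ) (n := N + 1) hu fun i => Set.mem_univ _)
    have hsum : c * angle (γ 0) (γ 1) ≤
        ∑ i ∈ Finset.range (N + 1), dist (γ (u (i + 1))) (γ (u i)) := by
      have := angle_le_sum_angle (fun i => γ (u i)) (N + 1)
        (norm_ne_zero_iff.1 (by rw [h1]; exact one_ne_zero))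
      simp only [hu0, hu1] at this
      refine (mul_le_mul_of_nonneg_left this hc0).trans ?_
      rw [Finset.mul_sum]
      refine Finset.sum_le_sum fun i _ => ?_
      rw [angle_comm, dist_eq_norm]
      exact hδc _ _ (h1 _) (h1 _) (by rw [← dist_eq_norm]; exact hstep i)
    refine (ENNReal.ofReal_le_ofReal hsum).trans ?_
    rw [ENNReal.ofReal_sum_of_nonneg fun _ _ => dist_nonneg]
    simp only [edist_dist, le_refl]
  have hlim : Tendsto (fun c : ℝ => ENNReal.ofReal (c * angle (γ 0) (γ 1))) (𝓝[<] 1)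
      (𝓝 (ENNReal.ofReal (angle (γ 0) (γ 1)))) := by
    have : Continuous fun c : ℝ => ENNReal.ofReal (c * angle (γ 0) (γ 1)) :=
      ENNReal.continuous_ofReal.comp (by fun_prop)
    simpa using (this.tendsto 1).mono_left nhdsWithin_le_nhds
  refine le_of_tendsto hlim ?_
  filter_upwards [Ioo_mem_nhdsLT (show (0 : ℝ) < 1 by norm_num)] with c hc
  exact key c hc.1.le hc.2

theorem segment_ne_zero {a b : E} (ha : ‖a‖ = 1) (hb : ‖b‖ = 1) (hab : a ≠ -b) {t : ℝ}
    (h0 : 0 ≤ t) (h1 : t ≤ 1) : (1 - t) • a + t • b ≠ 0 := by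
  intro h
  have h2 : (1 - t) • a = t • (-b) := by rw [smul_neg]; exact eq_neg_of_add_eq_zero_left h
  have h3 := congrArg norm h2
  rw [norm_smul, norm_smul, norm_neg, ha, hb, Real.norm_of_nonneg (by linarith),
    Real.norm_of_nonneg h0] at h3
  have ht : t ≠ 0 := by rintro rfl; norm_num at h3
  rw [show 1 - t = t by linarith] at h2
  exact hab (smul_right_injective E ht h2)

theorem norm_normalizedSegment {a b : E} (ha : ‖a‖ = 1) (hb : ‖b‖ = 1) (hab : a ≠ -b) {t : ℝ}
    (h0 : 0 ≤ t) (h1 : t ≤ 1) : ‖normalizedSegment a b t‖ = 1 := by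
  rw [normalizedSegment, norm_smul, norm_inv, norm_norm,
    inv_mul_cancel₀ (norm_ne_zero_iff.2 (segment_ne_zero ha hb hab h0 h1))]

theorem normalizedSegment_zero {a : E} (b : E) (ha : ‖a‖ = 1) : normalizedSegment a b 0 = a := by
  simp [normalizedSegment, ha]

theorem normalizedSegment_one (a : E) {b : E} (hb : ‖b‖ = 1) : normalizedSegment a b 1 = b := by
  simp [normalizedSegment, hb]

/-- Angles add up along a normalized segment. -/
theorem angle_normalizedSegment_add {a b : E} (ha : ‖a‖ = 1) (hb : ‖b‖ = 1) (hab : a ≠ -b)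
    {s t : ℝ} (hs : 0 ≤ s) (hst : s ≤ t) (ht : t ≤ 1) :
    angle a (normalizedSegment a b t) = angle a (normalizedSegment a b s) +
      angle (normalizedSegment a b s) (normalizedSegment a b t) := by
  have hs0 := segment_ne_zero ha hb hab hs (hst.trans ht)
  have ht0 := segment_ne_zero ha hb hab (hs.trans hst) ht
  simp only [normalizedSegment]
  rw [angle_smul_right_of_pos _ _ (inv_pos.2 (norm_pos_iff.2 ht0)),
    angle_smul_right_of_pos _ _ (inv_pos.2 (norm_pos_iff.2 hs0)),
    angle_smul_right_of_pos _ _ (inv_pos.2 (norm_pos_iff.2 ht0)),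
    angle_smul_left_of_pos _ _ (inv_pos.2 (norm_pos_iff.2 hs0))]
  refine angle_eq_angle_add_add_angle_add_of_mem_span hs0 ?_
  rw [Submodule.mem_span_pair]
  rcases (hs.trans hst).eq_or_lt with h | h
  · obtain rfl : s = t := by linarith
    exact ⟨0, 1, by simp⟩
  -- The point at time `s` of the straight segment is a convex combination of `a` and the point at
  -- time `t`.
  · refine ⟨Real.toNNReal (1 - s / t), Real.toNNReal (s / t), ?_⟩
    have h1 : s / t ≤ 1 := by rwa [div_le_one h]
    rw [NNReal.smul_def, NNReal.smul_def, Real.coe_toNNReal _ (sub_nonneg.2 h1),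
      Real.coe_toNNReal _ (by positivity)]
    simp only [smul_add, smul_smul, ← add_assoc, ← add_smul]
    congr 2 <;> field_simp
    ring

/-- Each chord is at most its angle, and by additivity the angles of a subdivision telescope. -/
theorem eVariationOn_normalizedSegment_le {a b : E} (ha : ‖a‖ = 1) (hb : ‖b‖ = 1) (hab : a ≠ -b) :
    eVariationOn (fun t : I => normalizedSegment a b t) Set.univ ≤ ENNReal.ofReal (angle a b) := by
  refine iSup_le ?_
  rintro ⟨n, u, hu, -⟩
  have hn : ∀ t : I, ‖normalizedSegment a b t‖ = 1 := fun t =>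
    norm_normalizedSegment ha hb hab t.2.1 t.2.2
  have hsum : ∑ i ∈ Finset.range n,
      dist (normalizedSegment a b (u (i + 1))) (normalizedSegment a b (u i)) ≤
      ∑ i ∈ Finset.range n,
        (angle a (normalizedSegment a b (u (i + 1))) - angle a (normalizedSegment a b (u i))) := by
    refine Finset.sum_le_sum fun i _ => ?_
    rw [angle_normalizedSegment_add ha hb hab (u i).2.1 (hu i.le_succ) (u (i + 1)).2.2,
      add_sub_cancel_left, dist_comm, dist_eq_norm]
    exact norm_sub_le_angle (hn _) (hn _)
  rw [Finset.sum_range_sub (fun i => angle a (normalizedSegment a b (u i)))] at hsum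
  have hlast : angle a (normalizedSegment a b (u n)) ≤ angle a b := by
    have := angle_normalizedSegment_add ha hb hab (u n).2.1 (u n).2.2 le_rfl
    rw [normalizedSegment_one a hb] at this
    linarith [angle_nonneg (normalizedSegment a b (u n)) b]
  have hle := hsum.trans ((sub_le_self _ (angle_nonneg _ _)).trans hlast)
  refine le_trans (le_of_eq ?_) (ENNReal.ofReal_le_ofReal hle)
  rw [ENNReal.ofReal_sum_of_nonneg fun _ _ => dist_nonneg]
  simp only [edist_dist]

theorem continuous_normalizedSegment {X : Type*} [TopologicalSpace X] {a b : X → E} {t : X → ℝ}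
    (ha : Continuous a) (hb : Continuous b) (ht : Continuous t) (ha1 : ∀ x, ‖a x‖ = 1)
    (hb1 : ∀ x, ‖b x‖ = 1) (hab : ∀ x, a x ≠ -b x) (ht0 : ∀ x, 0 ≤ t x) (ht1 : ∀ x, t x ≤ 1) :
    Continuous fun x => normalizedSegment (a x) (b x) (t x) := by
  have h : Continuous fun x => (1 - t x) • a x + t x • b x := by fun_prop
  exact (h.norm.inv₀ fun x => norm_ne_zero_iff.2
    (segment_ne_zero (ha1 x) (hb1 x) (hab x) (ht0 x) (ht1 x))).smul h

end Length

/-! ### The tangent field `ν` -/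

section RotField

variable {m : ℕ}

/-- The involution of the coordinates that exchanges `xᵢ` and `yᵢ`. -/
def pairSwap (k : Fin (2 * m)) : Fin (2 * m) :=
  if h : k.1 % 2 = 0 then ⟨k.1 + 1, by omega⟩ else ⟨k.1 - 1, by omega⟩

theorem pairSwap_involutive : Function.Involutive (pairSwap (m := m)) := by
  intro k
  apply Fin.ext
  unfold pairSwap
  split_ifs with h1 h2 h2 <;> simp only at h2 ⊢ <;> omega

/-- The sign with which a coordinate enters the field `ν`. -/
def pairSign (k : Fin (2 * m)) : ℝ := if k.1 % 2 = 0 then -1 else 1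

theorem pairSign_pairSwap (k : Fin (2 * m)) : pairSign (pairSwap k) = -pairSign k := by
  unfold pairSign pairSwap
  split_ifs with h1 h2 h2 <;> simp only at h2 ⊢ <;> first | omega | simp

theorem rotField_apply (v : EuclideanSpace ℝ (Fin (2 * m))) (k : Fin (2 * m)) :
    rotField v k = pairSign k * v (pairSwap k) := by
  simp only [rotField, pairSign, pairSwap]
  split_ifs <;> simp

theorem norm_rotField (v : EuclideanSpace ℝ (Fin (2 * m))) : ‖rotField v‖ = ‖v‖ := by
  rw [EuclideanSpace.norm_eq, EuclideanSpace.norm_eq,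
    ← Equiv.sum_comp (pairSwap_involutive (m := m)).toPerm]
  congr 1
  refine Finset.sum_congr rfl fun k _ => ?_
  have h : pairSign (pairSwap k) = -1 ∨ pairSign (pairSwap k) = 1 := by
    unfold pairSign; split_ifs <;> simp
  rw [Function.Involutive.coe_toPerm, rotField_apply, pairSwap_involutive k]
  rcases h with h | h <;> simp [h]

/-- Exchanging the coordinates in each pair flips the signs, so the sum equals its own negative. -/
theorem inner_rotField (v : EuclideanSpace ℝ (Fin (2 * m))) : inner ℝ v (rotField v) = 0 := by
  have h : inner ℝ v (rotField v) = -inner ℝ v (rotField v) := by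
    conv_lhs => rw [PiLp.inner_apply, ← Equiv.sum_comp (pairSwap_involutive (m := m)).toPerm]
    rw [PiLp.inner_apply, ← Finset.sum_neg_distrib]
    refine Finset.sum_congr rfl fun k _ => ?_
    rw [Function.Involutive.coe_toPerm, rotField_apply, rotField_apply, pairSwap_involutive k,
      pairSign_pairSwap]
    simp only [RCLike.inner_apply, conj_trivial]
    ring
  linarith

theorem continuous_rotField : Continuous (rotField (m := m)) := by
  refine (PiLp.continuous_toLp 2 _).comp (continuous_pi fun k => ?_)
  split_ifs <;> fun_prop

/-- Applied to a point and its `ν`, this keeps both halves of `antipodalPath` away from antipodal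
end points. -/
theorem ne_of_inner_eq_zero {E : Type*} [NormedAddCommGroup E] [InnerProductSpace ℝ E] {x y : E}
    (hx : ‖x‖ = 1) (h : inner ℝ x y = 0) : x ≠ y ∧ x ≠ -y := by
  constructor <;> rintro rfl <;> simp_all

end RotField

/-! ### Norm, end points and continuity of the explicit paths -/

section Paths

variable {m : ℕ} {X : Type*} [TopologicalSpace X]

local notation "𝔼" => EuclideanSpace ℝ (Fin (2 * m))

theorem norm_antipodalPath {b : 𝔼} (hb : ‖b‖ = 1) {t : ℝ} (h0 : 0 ≤ t) (h1 : t ≤ 1) :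
    ‖antipodalPath (-b) b t‖ = 1 := by
  have hn : ‖-b‖ = 1 := by rw [norm_neg, hb]
  have hr : ‖rotField (-b)‖ = 1 := by rw [norm_rotField, hn]
  have h := ne_of_inner_eq_zero hn (inner_rotField (-b))
  unfold antipodalPath
  split_ifs with ht
  · exact norm_normalizedSegment hn hr h.2 (by linarith) (by linarith)
  · exact norm_normalizedSegment hr hb h.1.symm (by linarith) (by linarith)

theorem norm_detourPath {a b : 𝔼} (ha : ‖a‖ = 1) (hb : ‖b‖ = 1) (hab : a ≠ b) {t : ℝ}
    (h0 : 0 ≤ t) (h1 : t ≤ 1) : ‖detourPath a b t‖ = 1 := by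
  unfold detourPath
  split_ifs with ht
  · exact norm_normalizedSegment ha (by rw [norm_neg, hb]) (by rwa [neg_neg]) (by linarith)
      (by linarith)
  · exact norm_antipodalPath hb (by linarith) (by linarith)

theorem continuous_antipodalPath {b : X → 𝔼} {t : X → ℝ} (hb : Continuous b) (ht : Continuous t)
    (hb1 : ∀ x, ‖b x‖ = 1) (ht0 : ∀ x, 0 ≤ t x) (ht1 : ∀ x, t x ≤ 1) :
    Continuous fun x => antipodalPath (-b x) (b x) (t x) := by
  have hn : ∀ x, ‖-b x‖ = 1 := fun x => by rw [norm_neg, hb1]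
  have hr : ∀ x, ‖rotField (-b x)‖ = 1 := fun x => by rw [norm_rotField, hn]
  have h := fun x => ne_of_inner_eq_zero (hn x) (inner_rotField (-b x))
  have hrc : Continuous fun x => rotField (-b x) := continuous_rotField.comp hb.neg
  refine continuous_if_le ht continuous_const ?_ ?_ ?_
  · rw [continuousOn_iff_continuous_domRestrict]
    exact continuous_normalizedSegment (X := {x | t x ≤ 1 / 2})
      (by fun_prop) (hrc.comp continuous_subtype_val) (by fun_prop) (fun x => hn x) (fun x => hr x)
      (fun x => (h x).2) (fun x => by linarith [ht0 x]) (fun x => by linarith [x.2.out])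
  · rw [continuousOn_iff_continuous_domRestrict]
    exact continuous_normalizedSegment (X := {x | 1 / 2 ≤ t x})
      (hrc.comp continuous_subtype_val) (by fun_prop) (by fun_prop) (fun x => hr x) (fun x => hb1 x)
      (fun x => (h x).1.symm) (fun x => by linarith [x.2.out]) (fun x => by linarith [ht1 x])
  · intro x hx
    rw [hx]
    norm_num [normalizedSegment_one _ (hr x), normalizedSegment_zero _ (hr x)]

theorem antipodalPath_zero {a : 𝔼} (b : 𝔼) (ha : ‖a‖ = 1) : antipodalPath a b 0 = a := by
  norm_num [antipodalPath, normalizedSegment_zero _ ha]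

theorem antipodalPath_one (a : 𝔼) {b : 𝔼} (hb : ‖b‖ = 1) : antipodalPath a b 1 = b := by
  norm_num [antipodalPath, normalizedSegment_one _ hb]

theorem detourPath_zero {a : 𝔼} (b : 𝔼) (ha : ‖a‖ = 1) : detourPath a b 0 = a := by
  norm_num [detourPath, normalizedSegment_zero _ ha]

theorem detourPath_one (a : 𝔼) {b : 𝔼} (hb : ‖b‖ = 1) : detourPath a b 1 = b := by
  norm_num [detourPath, antipodalPath_one _ hb]

theorem continuous_detourPath {a b : X → 𝔼} {t : X → ℝ} (ha : Continuous a) (hb : Continuous b)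
    (ht : Continuous t) (ha1 : ∀ x, ‖a x‖ = 1) (hb1 : ∀ x, ‖b x‖ = 1) (hab : ∀ x, a x ≠ b x)
    (ht0 : ∀ x, 0 ≤ t x) (ht1 : ∀ x, t x ≤ 1) :
    Continuous fun x => detourPath (a x) (b x) (t x) := by
  have hn : ∀ x, ‖-b x‖ = 1 := fun x => by rw [norm_neg, hb1]
  refine continuous_if_le ht continuous_const ?_ ?_ ?_
  · rw [continuousOn_iff_continuous_domRestrict]
    exact continuous_normalizedSegment (X := {x | t x ≤ 1 / 2})
      (by fun_prop) (by fun_prop) (by fun_prop) (fun x => ha1 x) (fun x => hn x)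
      (fun x => by rw [neg_neg]; exact hab x) (fun x => by linarith [ht0 x])
      (fun x => by linarith [x.2.out])
  · rw [continuousOn_iff_continuous_domRestrict]
    exact continuous_antipodalPath (X := {x | 1 / 2 ≤ t x})
      (by fun_prop) (by fun_prop) (fun x => hb1 x)
      (fun x => by linarith [x.2.out]) (fun x => by linarith [ht1 x])
  · intro x hx
    rw [hx]
    norm_num [normalizedSegment_one _ (hn x), antipodalPath_zero _ (hn x)]

end Paths

/-! ### The motion planner and its optimality -/

/-- The motion along normalized segments, between points that are not antipodal. -/
def segmentMotion (m : ℕ) :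
    C({p : OddSphere m × OddSphere m | p.1 ≠ -p.2}, C(I, OddSphere m)) :=
  ContinuousMap.curry
    { toFun := fun q => ⟨normalizedSegment q.1.1.1.1 q.1.1.2.1 q.2, mem_sphere_zero_iff_norm.2 <|
        norm_normalizedSegment (norm_eq_of_mem_sphere _) (norm_eq_of_mem_sphere _)
          (fun h => q.1.2 (Subtype.ext h)) q.2.2.1 q.2.2.2⟩
      continuous_toFun := (continuous_normalizedSegment (by fun_prop) (by fun_prop) (by fun_prop)
        (fun _ => norm_eq_of_mem_sphere _) (fun _ => norm_eq_of_mem_sphere _)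
        (fun q h => q.1.2 (Subtype.ext h)) (fun q => q.2.2.1) (fun q => q.2.2.2)).subtype_mk _ }

/-- The motion along detours, between distinct points. -/
def detourMotion (m : ℕ) :
    C({p : OddSphere m × OddSphere m | p.1 ≠ p.2}, C(I, OddSphere m)) :=
  ContinuousMap.curry
    { toFun := fun q => ⟨detourPath q.1.1.1.1 q.1.1.2.1 q.2, mem_sphere_zero_iff_norm.2 <|
        norm_detourPath (norm_eq_of_mem_sphere _) (norm_eq_of_mem_sphere _)
          (fun h => q.1.2 (Subtype.ext h)) q.2.2.1 q.2.2.2⟩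
      continuous_toFun := (continuous_detourPath (by fun_prop) (by fun_prop) (by fun_prop)
        (fun _ => norm_eq_of_mem_sphere _) (fun _ => norm_eq_of_mem_sphere _)
        (fun q h => q.1.2 (Subtype.ext h)) (fun q => q.2.2.1) (fun q => q.2.2.2)).subtype_mk _ }

/-- The motion planner on the odd sphere along normalized segments, with detours through the
field `ν`. -/
def oddSpherePlanner (m : ℕ) : MotionPlanner (OddSphere m) 2 where
  U := ![{p | p.1 ≠ -p.2}, {p | p.1 ≠ p.2}]
  isOpen_U := by
    rw [Fin.forall_fin_two]
    exact ⟨isOpen_ne_fun continuous_fst continuous_snd.neg,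
      isOpen_ne_fun continuous_fst continuous_snd⟩
  iUnion_U := by
    rw [Set.eq_univ_iff_forall]
    intro p
    rw [Set.mem_iUnion, Fin.exists_fin_two]
    by_contra! h
    obtain ⟨h1, h2⟩ := h
    have h1 : p.1 = -p.2 := not_not.1 h1
    have h2 : p.1 = p.2 := not_not.1 h2
    exact ne_neg_of_mem_unit_sphere ℝ p.2 (h2.symm.trans h1)
  s := Fin.cases (segmentMotion m) (Fin.cases (detourMotion m) nofun)
  continuous_s := by
    rw [Fin.forall_fin_two]
    exact ⟨(segmentMotion m).continuous, (detourMotion m).continuous⟩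
  source_s := by
    rw [Fin.forall_fin_two]
    exact ⟨fun p => Subtype.ext (normalizedSegment_zero _ (norm_eq_of_mem_sphere p.1.1)),
      fun p => Subtype.ext (detourPath_zero _ (norm_eq_of_mem_sphere p.1.1))⟩
  target_s := by
    rw [Fin.forall_fin_two]
    exact ⟨fun p => Subtype.ext (normalizedSegment_one _ (norm_eq_of_mem_sphere p.1.2)),
      fun p => Subtype.ext (detourPath_one _ (norm_eq_of_mem_sphere p.1.2))⟩

theorem topologicalComplexity_oddSphere {m : ℕ} (hm : 1 ≤ m) :
    topologicalComplexity (OddSphere m) = 2 :=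
  le_antisymm (sInf_le ⟨2, one_le_two, ⟨oddSpherePlanner m⟩, rfl⟩)
    (two_le_topologicalComplexity_oddSphere hm)

end

theorem mainTheorem3 (m : ℕ) (hm : 1 ≤ m) :
    topologicalComplexity (OddSphere m) = 2 ∧
    -- `ν` is a continuous unit tangent field on the sphere
    (Continuous (fun a : OddSphere m => rotField a.1) ∧
      ∀ a : OddSphere m, ‖rotField a.1‖ = 1 ∧ inner ℝ a.1 (rotField a.1) = 0) ∧
    -- the explicit two-set algorithm
    ∃ P : MotionPlanner (OddSphere m) 2,
      P.IsOptimal ∧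
      P.U 0 = {p | p.1 ≠ -p.2} ∧
      P.U 1 = {p | p.1 ≠ p.2} ∧
      (∀ (p : P.U 0) (t : unitInterval),
        (P.s 0 p t).1 = normalizedSegment p.1.1.1 p.1.2.1 (t : ℝ)) ∧
      (∀ (p : P.U 1) (t : unitInterval),
        (P.s 1 p t).1 = detourPath p.1.1.1 p.1.2.1 (t : ℝ)) ∧
      -- the paths of the first local algorithm are shortest paths on the sphere
      (∀ (p : P.U 0) (γ : C(unitInterval, OddSphere m)), γ 0 = p.1.1 → γ 1 = p.1.2 →
        OddSphere.pathLength (P.s 0 p) ≤ OddSphere.pathLength γ) := by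
  refine ⟨topologicalComplexity_oddSphere hm,
    ⟨continuous_rotField.comp continuous_subtype_val, fun a =>
      ⟨by rw [norm_rotField]; exact norm_eq_of_mem_sphere a, inner_rotField _⟩⟩,
    oddSpherePlanner m, (topologicalComplexity_oddSphere hm).symm, rfl, rfl, fun _ _ => rfl,
    fun _ _ => rfl, fun p γ h0 h1 => ?_⟩
  have hlow := ofReal_angle_le_eVariationOn (γ := fun t => (γ t : EuclideanSpace ℝ (Fin (2 * m))))
    (by fun_prop) fun t => norm_eq_of_mem_sphere _
  rw [h0, h1] at hlow
  exact (eVariationOn_normalizedSegment_le (norm_eq_of_mem_sphere p.1.1)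
    (norm_eq_of_mem_sphere p.1.2) fun h => p.2 (Subtype.ext h)).trans hlow
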